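/- Let $K\ge 1$, let $P\in[0,1]^{K\times K}$ be a symmetric matrix of rank $d$, and let $\rho\in\mathbb{R}^K$ be a probability vector. Let $\nu,\mu\in\mathbb{R}^{K\times d}$ satisfy $\nu\mu^T=P$, and denote their rows by $\nu_i,\mu_i$. Let $\alpha,\beta,\gamma>0$ be constants such that all eigenvalues of $\nu^T\nu$ and of $\mu^T\mu$ are greater than $\alpha$; for all $i\ne j$, $\beta<\|\nu_i-\nu_j\|$ or $\beta<\|\mu_i-\mu_j\|$; and $\gamma<\rho_i$ for all $i$. For each $n$, let $\tau=\tau^{(n)}:[n]\to[K]$ and $A=A^{(n)}\in\{0,1\}^{n\times n}$ be random, all defined on one probability space (with an arbitrary joint distribution across different $n$), and distributed according to the undirected stochastic blockmodel with parameters $P,\rho$: the block memberships $\tau(u)$, $u\in[n]$, are independent with $\mathbb{P}[\tau(u)=i]=\rho_i$; $A$ is symmetric with zero diagonal; and, conditionally on $\tau$, the entries $A_{uv}$ with $u<v$ are independent and $A_{uv}$ is Bernoulli with parameter $P_{\tau(u),\tau(v)}$ for all $u\neq v$. For $n\ge d$ let $\tilde U\in\mathbb{R}^{n\times d}$ consist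 of the first $d$ columns of $\tilde U'$, where $A=\tilde U'\tilde\Sigma'\tilde V'^T$ is a singular value decomposition with $\tilde U',\tilde V'$ orthogonal and singular values in decreasing order, and let $\hat\tau:[n]\to[K]$ be a block assignment function such that, together with some centroids $\hat\psi_1,\dots,\hat\psi_K\in\mathbb{R}^d$, it minimizes $$\sum_{u=1}^n\|\tilde U_u-\psi_{\tau'(u)}\|_2^2$$ over all $\psi_1,\dots,\psi_K\in\mathbb{R}^d$ and all $\tau':[n]\to[K]$, where $\tilde U_u$ is row $u$ of $\tilde U$. Then, with probability 1, for all but finitely many $n$ and every such choice of $\tilde U$ and $\hat\tau$, $$\min_{\pi\in\mathcal{S}_K}\bigl|\{u\in[n]:\tau(u)\ne\pi(\hat\tau(u))\}\bigr|\le\frac{2^2\,3^2\,6}{\alpha^5\beta^2\gamma^5}\log n,$$ where $\mathcal{S}_K$ is the set of permutations of $[K]$. -/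

import Mathlib

open MeasureTheory ProbabilityTheory Filter Matrix

/-- The undirected stochastic blockmodel on the node set `Fin n`, with edge probabilities `P` and
block probabilities `ρ`: `τ` is the random block membership function and `A` the random adjacency
matrix, both defined on the probability space `(Ω, Pr)`. -/
structure IsUndirectedSBM {Ω : Type*} [MeasurableSpace Ω] (Pr : Measure Ω) {K n : ℕ}
    (P : Matrix (Fin K) (Fin K) ℝ) (ρ : Fin K → ℝ)
    (τ : Ω → Fin n → Fin K) (A : Ω → Matrix (Fin n) (Fin n) ℝ) : Prop where
  /-- the block memberships are random variables -/
  measurable_block : ∀ u, Measurable fun ω => τ ω u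
  /-- the entries of the adjacency matrix are random variables -/
  measurable_entry : ∀ u v, Measurable fun ω => A ω u v
  /-- the block memberships are independent -/
  indep_block : iIndepFun (fun u ω => τ ω u) Pr
  /-- each node is in block `i` with probability `ρ i` -/
  block_prob : ∀ u i, Pr {ω | τ ω u = i} = ENNReal.ofReal (ρ i)
  /-- `A` has entries in `{0, 1}`, is symmetric, and has zero diagonal -/
  isAdjMatrix : ∀ ω, (A ω).IsAdjMatrix
  /-- conditionally on `τ`, the entries above the diagonal (one for each possible undirected edge)
  are independent -/
  indep_edge : ∀ t : Fin n → Fin K, Pr {ω | τ ω = t} ≠ 0 →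
    iIndepFun (fun (e : {p : Fin n × Fin n // p.1 < p.2}) ω => A ω e.1.1 e.1.2)
      (ProbabilityTheory.cond Pr {ω | τ ω = t})
  /-- conditionally on `τ`, the entry at `u ≠ v` is Bernoulli with parameter `P (τ u) (τ v)` -/
  edge_prob : ∀ t : Fin n → Fin K, Pr {ω | τ ω = t} ≠ 0 → ∀ u v, u ≠ v →
    ProbabilityTheory.cond Pr {ω | τ ω = t} {ω | A ω u v = 1} = ENNReal.ofReal (P (t u) (t v))

/-- `(U, V)` is an unscaled adjacency spectral embedding of `A` into dimension `d`: the columns of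
`U` and `V` are the first `d` columns of the orthogonal factors of some singular value
decomposition `A = U' Σ V'ᵀ`, with singular values in decreasing order. -/
def IsUnscaledEmbedding {n : ℕ} (d : ℕ) (A : Matrix (Fin n) (Fin n) ℝ)
    (U V : Matrix (Fin n) (Fin d) ℝ) : Prop :=
  ∃ (hd : d ≤ n) (U' V' : Matrix (Fin n) (Fin n) ℝ) (σ : Fin n → ℝ),
    U' ∈ Matrix.orthogonalGroup (Fin n) ℝ ∧ V' ∈ Matrix.orthogonalGroup (Fin n) ℝ ∧
    Antitone σ ∧ (∀ i, 0 ≤ σ i) ∧ A = U' * Matrix.diagonal σ * V'ᵀ ∧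
    (∀ u j, U u j = U' u (Fin.castLE hd j)) ∧ (∀ u j, V u j = V' u (Fin.castLE hd j))

/-- The Euclidean norm of a vector in `ℝᵐ`. -/
noncomputable def euclNorm {m : ℕ} (x : Fin m → ℝ) : ℝ :=
  ‖(WithLp.toLp 2 x : EuclideanSpace ℝ (Fin m))‖

/-- The square error of assigning row `u` of `Z` to the centroid `ψ (t u)`. -/
noncomputable def squareError {n m K : ℕ} (Z : Matrix (Fin n) (Fin m) ℝ)
    (ψ : Matrix (Fin K) (Fin m) ℝ) (t : Fin n → Fin K) : ℝ :=
  ∑ u, euclNorm (Z u - ψ (t u)) ^ 2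

/-- `(ψ, t)` is a clustering of the rows of `Z` into `K` blocks which minimizes the square error
over all choices of centroids and all block assignment functions. -/
def IsSquareErrorClustering {n m K : ℕ} (Z : Matrix (Fin n) (Fin m) ℝ)
    (ψ : Matrix (Fin K) (Fin m) ℝ) (t : Fin n → Fin K) : Prop :=
  ∀ (ψ' : Matrix (Fin K) (Fin m) ℝ) (t' : Fin n → Fin K),
    squareError Z ψ t ≤ squareError Z ψ' t'

/-- The number of nodes misassigned by `t'`, minimized over relabelings of the blocks. -/
noncomputable def misassigned {n K : ℕ} (t t' : Fin n → Fin K) : ℕ :=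
  ⨅ π : Equiv.Perm (Fin K), (Finset.univ.filter fun u => t u ≠ π (t' u)).card

/-! Let `M = P.submatrix τ τ`, which factors through dimension `d` as `X * Yᵀ`, where `X` and `Y`
repeat the rows of `ν` and `μ` along `τ`. Everything is compared through `A * A` and `M * M`: off
the diagonal, entries of `A * A` count two-edge paths, which concentrate by Hoeffding, and
Borel–Cantelli gives `‖A² - M²‖_F² ≤ 3 n³ log n` almost surely for large `n`
(`ae_eventually_sum_sq_le`).

The rest is deterministic (`misassigned_le_of_frobSq_le`). Blocks have at least `γ n` nodes, so with
`κ = α γ n` the form of `M²` is at least `κ²` on the range of `X`; Courant–Fischer carries this to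
the top `d` eigenvalues of `A²`. A Davis–Kahan argument then shows that the projection `Q` onto the
range of `X` nearly fixes the embedding: `ε = ‖U - Q U‖_F²` has order `log n / n`. The rows of `Q *
U` depend only on the block, and rows from distinct blocks are at squared distance at least `g`, of
order `1 / n`. A minimal clustering therefore errs on at most `16 ε / g` nodes
(`misassigned_le_of_isSquareErrorClustering`), which is of order `log n`. -/

/-! ### Hoeffding bounds for independent variables in the unit interval. -/

section Hoeffding

variable {Ω : Type*} [MeasurableSpace Ω] {m : Measure Ω}

/-- Disjoint groups of independent variables are independent; a group here is the two edges of a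
path of length two. -/
lemma iIndepFun_mul_pair {ι : Type*} {f : ι × Bool → Ω → ℝ} (hf : iIndepFun f m)
    (hm : ∀ i, Measurable (f i)) :
    iIndepFun (fun w ω => f (w, false) ω * f (w, true) ω) m := by
  classical
  have := hf.isProbabilityMeasure
  rw [iIndepFun_iff_measure_inter_preimage_eq_mul]
  intro S
  induction S using Finset.induction_on with
  | empty => simp
  | insert a S ha ih =>
    intro sets hs
    rw [Finset.prod_insert ha, ← ih fun i hi => hs i (Finset.mem_insert_of_mem hi),
      Finset.set_biInter_insert]
    have hdisj : Disjoint ({(a, false), (a, true)} : Finset (ι × Bool)) (S ×ˢ Finset.univ) := by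
      rw [Finset.disjoint_left]
      rintro ⟨x, b⟩ hx hx'
      simp at hx hx'
      rcases hx with h | h <;> exact ha (h.1 ▸ hx')
    have hind := hf.indepFun_finset _ _ hdisj hm
    have key := hind.measure_inter_preimage_eq_mul
      ((fun x => x ⟨(a, false), by simp⟩ * x ⟨(a, true), by simp⟩) ⁻¹' sets a)
      (⋂ i : S, (fun x => x ⟨(i.1, false), by simp⟩ * x ⟨(i.1, true), by simp⟩) ⁻¹' sets i)
      (measurableSet_preimage (by fun_prop) (hs a (by simp)))
      (MeasurableSet.iInter fun i => measurableSet_preimage (by fun_prop)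
        (hs i (Finset.mem_insert_of_mem i.2)))
    convert key using 2
    · congr 1
      ext ω; simp
    all_goals
      refine congrArg m ?_
      ext ω; simp

/-- The number of summands enters only through a bound `n`, so a sum over the middle nodes of paths
can be bounded in terms of `n` itself. -/
lemma measureReal_le_sum_sub_integral {ι : Type*} {X : ι → Ω → ℝ} (hX : iIndepFun X m)
    (hm : ∀ i, Measurable (X i)) (h01 : ∀ i ω, X i ω ∈ Set.Icc (0 : ℝ) 1) {s : Finset ι} {n : ℕ}
    (hs : s.Nonempty) (hn : s.card ≤ n) {ε : ℝ} (hε : 0 ≤ ε) :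
    m.real {ω | ε ≤ ∑ i ∈ s, (X i ω - ∫ ω, X i ω ∂m)} ≤ Real.exp (-2 * ε ^ 2 / n) := by
  have := hX.isProbabilityMeasure
  have hi : iIndepFun (fun i ω => X i ω - ∫ ω, X i ω ∂m) m :=
    hX.comp (fun i x => x - ∫ ω, X i ω ∂m) (fun i => by fun_prop)
  refine (HasSubgaussianMGF.measure_sum_ge_le_of_iIndepFun hi
    (fun i _ => hasSubgaussianMGF_of_mem_Icc (hm i).aemeasurable
      (Eventually.of_forall (h01 i))) hε).trans ?_
  have hc : 0 < (s.card : ℝ) := by exact_mod_cast hs.card_pos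
  have hc' : (s.card : ℝ) ≤ n := by exact_mod_cast hn
  apply Real.exp_le_exp.2
  simp only [Finset.sum_const, nsmul_eq_mul]
  push_cast
  simp only [sub_zero, norm_one]
  rw [div_le_div_iff₀ (by positivity) (by linarith)]
  nlinarith [sq_nonneg ε]

lemma measureReal_le_sum_integral_sub {ι : Type*} {X : ι → Ω → ℝ} (hX : iIndepFun X m)
    (hm : ∀ i, Measurable (X i)) (h01 : ∀ i ω, X i ω ∈ Set.Icc (0 : ℝ) 1) {s : Finset ι} {n : ℕ}
    (hs : s.Nonempty) (hn : s.card ≤ n) {ε : ℝ} (hε : 0 ≤ ε) :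
    m.real {ω | ε ≤ ∑ i ∈ s, ((∫ ω, X i ω ∂m) - X i ω)} ≤ Real.exp (-2 * ε ^ 2 / n) := by
  have := hX.isProbabilityMeasure
  have hint : ∀ i, Integrable (X i) m := fun i =>
    Integrable.of_mem_Icc 0 1 (hm i).aemeasurable (Eventually.of_forall (h01 i))
  have h := measureReal_le_sum_sub_integral (X := fun i ω => 1 - X i ω)
    (hX.comp (fun i x => 1 - x) (fun i => by fun_prop)) (fun i => (hm i).const_sub 1)
    (fun i ω => by have := h01 i ω; constructor <;> linarith [this.1, this.2]) hs hn hε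
  convert h using 6
  rw [integral_sub (integrable_const _) (hint _)]
  simp

lemma measureReal_le_abs_sum_sub_integral {ι : Type*} {X : ι → Ω → ℝ} (hX : iIndepFun X m)
    (hm : ∀ i, Measurable (X i)) (h01 : ∀ i ω, X i ω ∈ Set.Icc (0 : ℝ) 1) {s : Finset ι} {n : ℕ}
    (hs : s.Nonempty) (hn : s.card ≤ n) {ε : ℝ} (hε : 0 ≤ ε) :
    m.real {ω | ε ≤ |∑ i ∈ s, (X i ω - ∫ ω, X i ω ∂m)|} ≤ 2 * Real.exp (-2 * ε ^ 2 / n) := by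
  have := hX.isProbabilityMeasure
  calc _ ≤ m.real ({ω | ε ≤ ∑ i ∈ s, (X i ω - ∫ ω, X i ω ∂m)} ∪
        {ω | ε ≤ ∑ i ∈ s, ((∫ ω, X i ω ∂m) - X i ω)}) := by
        refine measureReal_mono ?_ (measure_ne_top _ _)
        intro ω hω
        simp only [Set.mem_ofPred_eq, Set.mem_union] at hω ⊢
        have h : ∑ i ∈ s, ((∫ ω, X i ω ∂m) - X i ω) = - ∑ i ∈ s, (X i ω - ∫ ω, X i ω ∂m) := by
          rw [← Finset.sum_neg_distrib]; simp
        rw [h]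
        exact le_abs.1 hω
    _ ≤ _ := by
        refine (measureReal_union_le _ _).trans ?_
        linarith [measureReal_le_sum_sub_integral hX hm h01 hs hn hε,
          measureReal_le_sum_integral_sub hX hm h01 hs hn hε]

end Hoeffding

/-! ### Concentration of block sizes and codegrees for fixed `n`. -/

section Model

lemma ae_eventually_notMem_of_measureReal_le {Ω : Type*} [MeasurableSpace Ω] {Pr : Measure Ω}
    [IsFiniteMeasure Pr] {S : ℕ → Set Ω} {f : ℕ → ℝ} (hf : Summable f) (N : ℕ)
    (h : ∀ n, N ≤ n → Pr.real (S n) ≤ f n) : ∀ᵐ ω ∂Pr, ∀ᶠ n in atTop, ω ∉ S n := by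
  have hs : Summable fun n => Pr.real (S n) :=
    (summable_nat_add_iff N).1 (Summable.of_nonneg_of_le (fun _ => measureReal_nonneg)
      (fun n => h (n + N) (Nat.le_add_left _ _)) ((summable_nat_add_iff N).2 hf))
  refine ae_eventually_notMem (ne_of_eq_of_ne ?_ hs.tsum_ofReal_ne_top)
  exact tsum_congr fun n => (ofReal_measureReal).symm

variable {Ω : Type*} [MeasurableSpace Ω] {Pr : Measure Ω} [IsProbabilityMeasure Pr]
  {K n : ℕ} {P : Matrix (Fin K) (Fin K) ℝ} {ρ : Fin K → ℝ}
  {τ : Ω → Fin n → Fin K} {A : Ω → Matrix (Fin n) (Fin n) ℝ}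

lemma IsUndirectedSBM.measureReal_blockSize_lt (h : IsUndirectedSBM Pr P ρ τ A) (hn : 0 < n)
    {γ : ℝ} (i : Fin K) (hγ : 0 < γ) (hi : γ < ρ i) :
    Pr.real {ω | ((Finset.univ.filter fun u => τ ω u = i).card : ℝ) < γ * n} ≤
      Real.exp (-2 * (ρ i - γ) ^ 2 * n) := by
  classical
  set X : Fin n → Ω → ℝ := fun u ω => if τ ω u = i then 1 else 0 with hXdef
  have hX : iIndepFun X Pr :=
    h.indep_block.comp (fun _ x => if x = i then (1 : ℝ) else 0) (fun _ => measurable_of_finite _)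
  have hm : ∀ u, Measurable (X u) := fun u =>
    (measurable_of_finite fun x => if x = i then (1 : ℝ) else 0).comp (h.measurable_block u)
  have hint : ∀ u, ∫ ω, X u ω ∂Pr = ρ i := by
    intro u
    have hs : MeasurableSet {ω | τ ω u = i} := h.measurable_block u (measurableSet_singleton i)
    have : X u = {ω | τ ω u = i}.indicator fun _ => (1 : ℝ) := by
      ext ω; simp [hXdef, Set.indicator]
    rw [this, integral_indicator hs]
    simp [measureReal_def, h.block_prob, (hγ.trans hi).le]
  have hn' : (0 : ℝ) < n := by exact_mod_cast hn
  have : NeZero n := ⟨hn.ne'⟩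
  refine le_trans (measureReal_mono ?_) ((measureReal_le_sum_integral_sub hX hm
    (fun u ω => by simp only [hXdef]; split_ifs <;> simp) (s := Finset.univ) (n := n)
    Finset.univ_nonempty (by simp) (ε := n * (ρ i - γ))
    (mul_nonneg hn'.le (by linarith))).trans_eq ?_)
  · intro ω hω
    simp only [Set.mem_ofPred_eq] at hω ⊢
    simp only [hint]
    simp only [Finset.sum_sub_distrib, Finset.sum_const, Finset.card_univ, Fintype.card_fin,
      nsmul_eq_mul, hXdef, Finset.sum_boole]
    linarith
  · congr 1
    field_simp

/-- The undirected edge joining two distinct nodes, with its ends in increasing order. -/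
def edgeOf {n : ℕ} (u v : Fin n) (h : u ≠ v) : {p : Fin n × Fin n // p.1 < p.2} :=
  if hlt : u < v then ⟨(u, v), hlt⟩ else ⟨(v, u), lt_of_le_of_ne (not_lt.1 hlt) h.symm⟩

lemma sym2_edgeOf {u v : Fin n} (h : u ≠ v) :
    s((edgeOf u v h).1.1, (edgeOf u v h).1.2) = s(u, v) := by
  unfold edgeOf
  split_ifs <;> simp [Sym2.eq_swap]

lemma apply_edgeOf {M : Matrix (Fin n) (Fin n) ℝ} (hM : M.IsSymm) {u v : Fin n} (h : u ≠ v) :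
    M (edgeOf u v h).1.1 (edgeOf u v h).1.2 = M u v := by
  unfold edgeOf
  split_ifs
  · rfl
  · exact hM.apply u v

/-- The edges `{u, w}` and `{w, v}` of the paths of length two from `u` to `v`. -/
def pathEdge (u v : Fin n) (q : {w : Fin n // w ≠ u ∧ w ≠ v} × Bool) :
    {p : Fin n × Fin n // p.1 < p.2} :=
  if q.2 then edgeOf q.1.1 v q.1.2.2 else edgeOf u q.1.1 q.1.2.1.symm

/-- This is what makes the path products independent. It fails for `u = v`, where both legs of a
path are the same edge; the diagonal of `A * A` needs separate treatment. -/
lemma pathEdge_injective {u v : Fin n} (huv : u ≠ v) : Function.Injective (pathEdge u v) := by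
  rintro ⟨⟨w, hw⟩, b⟩ ⟨⟨w', hw'⟩, b'⟩ he
  have he' := congrArg (fun e => s(e.1.1, e.1.2)) he
  cases b <;> cases b' <;> simp [pathEdge, sym2_edgeOf] at he' <;> simp <;> tauto

/-- Hoeffding applies to the middle nodes `w ∉ {u, v}`; the slack `2` pays for the two remaining
terms. The condition `3 ≤ n` provides a middle node. -/
lemma IsUndirectedSBM.cond_codegree (h : IsUndirectedSBM Pr P ρ τ A)
    (hP : ∀ i j, P i j ∈ Set.Icc (0 : ℝ) 1) (hn : 3 ≤ n) (t : Fin n → Fin K)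
    (ht : Pr {ω | τ ω = t} ≠ 0) {u v : Fin n} (huv : u ≠ v) {s : ℝ} (hs : 0 ≤ s) :
    (ProbabilityTheory.cond Pr {ω | τ ω = t}).real
      {ω | s + 2 ≤ |∑ w, A ω u w * A ω w v - ∑ w, P (t u) (t w) * P (t w) (t v)|} ≤
        2 * Real.exp (-2 * s ^ 2 / n) := by
  classical
  set Q := ProbabilityTheory.cond Pr {ω | τ ω = t} with hQ
  have : IsProbabilityMeasure Q := cond_isProbabilityMeasure ht
  have h01 : ∀ ω a b, A ω a b ∈ Set.Icc (0 : ℝ) 1 := fun ω a b => by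
    rcases (h.isAdjMatrix ω).zero_or_one a b with h | h <;> simp [h]
  have hmean : ∀ a b, a ≠ b → ∫ ω, A ω a b ∂Q = P (t a) (t b) := by
    intro a b hab
    have hs : MeasurableSet {ω | A ω a b = 1} :=
      h.measurable_entry a b (measurableSet_singleton 1)
    have : (fun ω => A ω a b) = {ω | A ω a b = 1}.indicator fun _ => (1 : ℝ) := by
      ext ω
      rcases (h.isAdjMatrix ω).zero_or_one a b with h | h <;> simp [h]
    rw [this, integral_indicator hs]
    simp [measureReal_def, hQ, h.edge_prob t ht a b hab, (hP _ _).1]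
  have hI : iIndepFun (fun q ω => A ω (pathEdge u v q).1.1 (pathEdge u v q).1.2) Q :=
    (h.indep_edge t ht).precomp (pathEdge_injective huv)
  have hme : ∀ q, Measurable fun ω => A ω (pathEdge u v q).1.1 (pathEdge u v q).1.2 :=
    fun q => h.measurable_entry _ _
  have hZ := iIndepFun_mul_pair hI hme
  have hf : ∀ (w : {w : Fin n // w ≠ u ∧ w ≠ v}) ω,
      A ω (pathEdge u v (w, false)).1.1 (pathEdge u v (w, false)).1.2 = A ω u w := fun w ω => by
    simp [pathEdge, apply_edgeOf (h.isAdjMatrix ω).symm]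
  have htr : ∀ (w : {w : Fin n // w ≠ u ∧ w ≠ v}) ω,
      A ω (pathEdge u v (w, true)).1.1 (pathEdge u v (w, true)).1.2 = A ω w v := fun w ω => by
    simp [pathEdge, apply_edgeOf (h.isAdjMatrix ω).symm]
  have hmeanZ : ∀ w : {w : Fin n // w ≠ u ∧ w ≠ v},
      ∫ ω, A ω u w * A ω w v ∂Q = P (t u) (t w) * P (t w) (t v) := by
    intro w
    have hi := hI.indepFun (i := (w, false)) (j := (w, true)) (by simp)
    simp only [hf, htr] at hi
    rw [← hmean u w w.2.1.symm, ← hmean w v w.2.2]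
    exact hi.integral_fun_mul_eq_mul_integral (h.measurable_entry _ _).aestronglyMeasurable
      (h.measurable_entry _ _).aestronglyMeasurable
  simp only [hf, htr] at hZ
  have hne : (Finset.univ : Finset {w : Fin n // w ≠ u ∧ w ≠ v}).Nonempty := by
    have : ∃ w : Fin n, w ∉ ({u, v} : Finset (Fin n)) := by
      by_contra! hc
      have : (Finset.univ : Finset (Fin n)).card ≤ 2 :=
        (Finset.card_le_card fun w _ => hc w).trans Finset.card_le_two
      simp at this; omega
    obtain ⟨w, hw⟩ := this
    simp at hw
    exact ⟨⟨w, hw⟩, Finset.mem_univ _⟩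
  refine le_trans (measureReal_mono ?_) (measureReal_le_abs_sum_sub_integral hZ
    (fun w => (h.measurable_entry _ _).mul (h.measurable_entry _ _))
    (fun w ω => unitInterval.mul_mem (h01 _ _ _) (h01 _ _ _)) hne
    ((Finset.card_le_univ _).trans ((Fintype.card_subtype_le _).trans (Fintype.card_fin n).le)) hs)
  intro ω hω
  simp only [Set.mem_ofPred_eq, hmeanZ] at hω ⊢
  rw [← Finset.sum_sub_distrib] at hω
  set F : Fin n → ℝ := fun w => A ω u w * A ω w v - P (t u) (t w) * P (t w) (t v) with hF
  have hsplit : ∑ w, F w = (F u + F v) + ∑ w : {w : Fin n // w ≠ u ∧ w ≠ v}, F w := by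
    rw [← Finset.sum_pair huv, ← Finset.sum_add_sum_compl {u, v}]
    congr 1
    rw [← Finset.sum_subtype]
    intro x; simp
  -- The diagonal of `A` vanishes, so only the product of two entries of `P` survives.
  have hu : |F u| ≤ 1 := by
    have := unitInterval.mul_mem (hP (t u) (t u)) (hP (t u) (t v))
    simp only [hF, (h.isAdjMatrix ω).apply_diag, zero_mul, zero_sub, abs_neg]
    rw [abs_of_nonneg this.1]; exact this.2
  have hv : |F v| ≤ 1 := by
    have := unitInterval.mul_mem (hP (t u) (t v)) (hP (t v) (t v))
    simp only [hF, (h.isAdjMatrix ω).apply_diag, mul_zero, zero_sub, abs_neg]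
    rw [abs_of_nonneg this.1]; exact this.2
  change s + 2 ≤ |∑ w, F w| at hω
  change s ≤ |∑ w : {w : Fin n // w ≠ u ∧ w ≠ v}, F w|
  rw [hsplit] at hω
  linarith [abs_add_le (F u + F v) (∑ w : {w : Fin n // w ≠ u ∧ w ≠ v}, F w), abs_add_le (F u) (F v)]

/-- The conditional bound is uniform in `t`, so it survives averaging over the values of `τ`; null
values contribute nothing. -/
lemma IsUndirectedSBM.measureReal_codegree (h : IsUndirectedSBM Pr P ρ τ A)
    (hP : ∀ i j, P i j ∈ Set.Icc (0 : ℝ) 1) (hn : 3 ≤ n) {u v : Fin n} (huv : u ≠ v) {s : ℝ}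
    (hs : 0 ≤ s) :
    Pr.real {ω | s + 2 ≤ |∑ w, A ω u w * A ω w v -
      ∑ w, P (τ ω u) (τ ω w) * P (τ ω w) (τ ω v)|} ≤ 2 * Real.exp (-2 * s ^ 2 / n) := by
  classical
  set S := {ω | s + 2 ≤ |∑ w, A ω u w * A ω w v -
      ∑ w, P (τ ω u) (τ ω w) * P (τ ω w) (τ ω v)|} with hS
  have hT : ∀ t, MeasurableSet {ω | τ ω = t} := fun t =>
    measurable_pi_iff.2 h.measurable_block (measurableSet_singleton t)
  have htot : ∑ t, Pr.real {ω | τ ω = t} = 1 := by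
    rw [← measureReal_iUnion_fintype (fun t t' htt => Set.disjoint_left.2 fun ω h1 h2 =>
      htt (h1.symm.trans h2)) hT]
    rw [show (⋃ t, {ω | τ ω = t}) = Set.univ by ext ω; simp]
    simp
  have hcov : S = ⋃ t, {ω | τ ω = t} ∩ S := by ext ω; simp
  calc Pr.real S ≤ ∑ t, Pr.real ({ω | τ ω = t} ∩ S) := by
        conv_lhs => rw [hcov]
        exact measureReal_iUnion_fintype_le _
    _ ≤ ∑ t, 2 * Real.exp (-2 * s ^ 2 / n) * Pr.real {ω | τ ω = t} := by
        refine Finset.sum_le_sum fun t _ => ?_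
        by_cases ht : Pr {ω | τ ω = t} = 0
        · have : Pr.real ({ω | τ ω = t} ∩ S) = 0 := by
            rw [measureReal_def, measure_mono_null Set.inter_subset_left ht]; rfl
          rw [this]; positivity
        · have hc := h.cond_codegree hP hn t ht huv hs
          have hsub : {ω | τ ω = t} ∩ S ⊆ {ω | τ ω = t} ∩ {ω | s + 2 ≤
              |∑ w, A ω u w * A ω w v - ∑ w, P (t u) (t w) * P (t w) (t v)|} := by
            rintro ω ⟨h1, h2⟩
            refine ⟨h1, ?_⟩
            simp only [Set.mem_ofPred_eq] at h1
            subst h1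
            exact h2
          refine (measureReal_mono hsub).trans ?_
          rw [measureReal_def, ← cond_mul_eq_inter (hT t), ENNReal.toReal_mul]
          exact mul_le_mul_of_nonneg_right hc ENNReal.toReal_nonneg
    _ = _ := by rw [← Finset.mul_sum, htot, mul_one]

lemma IsUndirectedSBM.measureReal_exists_codegree (h : IsUndirectedSBM Pr P ρ τ A)
    (hP : ∀ i j, P i j ∈ Set.Icc (0 : ℝ) 1) (hn : 3 ≤ n) {s : ℝ} (hs : 0 ≤ s) :
    Pr.real {ω | ∃ u v, u ≠ v ∧ s + 2 ≤ |∑ w, A ω u w * A ω w v -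
      ∑ w, P (τ ω u) (τ ω w) * P (τ ω w) (τ ω v)|} ≤ n ^ 2 * (2 * Real.exp (-2 * s ^ 2 / n)) := by
  classical
  set S : Fin n × Fin n → Set Ω := fun q => {ω | q.1 ≠ q.2 ∧ s + 2 ≤
    |∑ w, A ω q.1 w * A ω w q.2 - ∑ w, P (τ ω q.1) (τ ω w) * P (τ ω w) (τ ω q.2)|} with hS
  calc _ ≤ Pr.real (⋃ q, S q) := measureReal_mono (by
        rintro ω ⟨u, v, hω⟩
        exact Set.mem_iUnion.2 ⟨(u, v), hω⟩)
    _ ≤ ∑ q, Pr.real (S q) := measureReal_iUnion_fintype_le _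
    _ ≤ ∑ q : Fin n × Fin n, 2 * Real.exp (-2 * s ^ 2 / n) := by
        refine Finset.sum_le_sum fun q _ => ?_
        by_cases hq : q.1 = q.2
        · have : S q = ∅ := by ext ω; simp [hS, hq]
          rw [this, measureReal_empty]; positivity
        · exact (measureReal_mono fun ω hω => hω.2).trans (h.measureReal_codegree hP hn hq hs)
    _ = _ := by simp; ring

end Model

/-! ### Almost sure bounds by Borel–Cantelli. -/

section AlmostSure

variable {Ω : Type*} [MeasurableSpace Ω] {Pr : Measure Ω} [IsProbabilityMeasure Pr]
  {K : ℕ} {P : Matrix (Fin K) (Fin K) ℝ} {ρ : Fin K → ℝ}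
  {τ : (n : ℕ) → Ω → Fin n → Fin K} {A : (n : ℕ) → Ω → Matrix (Fin n) (Fin n) ℝ}

lemma ae_eventually_le_blockSize (h : ∀ n, IsUndirectedSBM Pr P ρ (τ n) (A n)) {γ : ℝ}
    (hγ : 0 < γ) (hγρ : ∀ i, γ < ρ i) :
    ∀ᵐ ω ∂Pr, ∀ᶠ n : ℕ in atTop, ∀ i,
      γ * n ≤ ((Finset.univ.filter fun u => τ n ω u = i).card : ℝ) := by
  have key : ∀ i, ∀ᵐ ω ∂Pr, ∀ᶠ n : ℕ in atTop,
      γ * n ≤ ((Finset.univ.filter fun u => τ n ω u = i).card : ℝ) := by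
    intro i
    have hr : Real.exp (-2 * (ρ i - γ) ^ 2) < 1 := by
      have := pow_pos (sub_pos.2 (hγρ i)) 2
      rw [Real.exp_lt_one_iff]; linarith
    have := ae_eventually_notMem_of_measureReal_le
      (summable_geometric_of_lt_one (Real.exp_pos _).le hr) 1 fun n hn =>
        ((h n).measureReal_blockSize_lt hn i hγ (hγρ i)).trans_eq (by
          rw [← Real.exp_nat_mul, mul_comm])
    filter_upwards [this] with ω hω
    filter_upwards [hω] with n hn
    simpa using hn
  filter_upwards [ae_all_iff.2 key] with ω hω
  exact eventually_all.2 hω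

lemma ae_eventually_codegree (h : ∀ n, IsUndirectedSBM Pr P ρ (τ n) (A n))
    (hP : ∀ i j, P i j ∈ Set.Icc (0 : ℝ) 1) :
    ∀ᵐ ω ∂Pr, ∀ᶠ n : ℕ in atTop, ∀ u v, u ≠ v →
      |∑ w, A n ω u w * A n ω w v - ∑ w, P (τ n ω u) (τ n ω w) * P (τ n ω w) (τ n ω v)| ≤
        √(2 * n * Real.log n) + 2 := by
  -- With `s² = 2 n log n` each pair fails with probability at most `2 n⁻⁴`, and there are `n²`
  -- pairs.
  have hsum : Summable fun n : ℕ => 2 * (1 / (n : ℝ) ^ 2) :=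
    (Real.summable_one_div_nat_pow.2 one_lt_two).mul_left 2
  have := ae_eventually_notMem_of_measureReal_le hsum 3 fun n hn =>
    ((h n).measureReal_exists_codegree hP hn (Real.sqrt_nonneg (2 * n * Real.log n))).trans_eq (by
      have hn' : (0 : ℝ) < n := by exact_mod_cast (by omega : 0 < n)
      have h1 : (1 : ℝ) ≤ n := by exact_mod_cast (by omega : 1 ≤ n)
      rw [Real.sq_sqrt (mul_nonneg (by positivity) (Real.log_nonneg h1)),
        show -2 * (2 * n * Real.log n) / n = -((4 : ℕ) * Real.log n) by field_simp; norm_num [mul_comm],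
        Real.exp_neg, Real.exp_nat_mul, Real.exp_log hn']
      field_simp)
  filter_upwards [this] with ω hω
  filter_upwards [hω] with n hn u v huv
  by_contra hc
  exact hn ⟨u, v, huv, (not_le.1 hc).le⟩

lemma eventually_add_le_mul_log :
    ∀ᶠ n : ℕ in atTop, (n : ℝ) + 20 ≤ 1 / 2 * (n * Real.log n) := by
  have h1 := (Real.tendsto_log_atTop.comp tendsto_natCast_atTop_atTop).eventually_ge_atTop 4
  filter_upwards [h1, eventually_ge_atTop 20] with n hn hn'
  have : (20 : ℝ) ≤ n := by exact_mod_cast hn'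
  simp only [Function.comp] at hn
  nlinarith

lemma ae_eventually_sum_sq_le (h : ∀ n, IsUndirectedSBM Pr P ρ (τ n) (A n))
    (hP : ∀ i j, P i j ∈ Set.Icc (0 : ℝ) 1) :
    ∀ᵐ ω ∂Pr, ∀ᶠ n : ℕ in atTop,
      ∑ u, ∑ v, ((A n ω * A n ω - P.submatrix (τ n ω) (τ n ω) * P.submatrix (τ n ω) (τ n ω)) u v) ^ 2
        ≤ 3 * n ^ 3 * Real.log n := by
  filter_upwards [ae_eventually_codegree h hP] with ω hω
  filter_upwards [hω, eventually_add_le_mul_log, eventually_ge_atTop 1] with n hn hlog h1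
  have h1' : (1 : ℝ) ≤ n := by exact_mod_cast h1
  have hl := Real.log_nonneg h1'
  set s := √(2 * n * Real.log n) with hs
  have hs2 : s ^ 2 = 2 * n * Real.log n := Real.sq_sqrt (by positivity)
  set D := A n ω * A n ω - P.submatrix (τ n ω) (τ n ω) * P.submatrix (τ n ω) (τ n ω) with hD
  have h01 : ∀ a b, A n ω a b ∈ Set.Icc (0 : ℝ) 1 := fun a b => by
    rcases ((h n).isAdjMatrix ω).zero_or_one a b with h | h <;> simp [h]
  -- Off the diagonal, `(s + 2)² ≤ 5/4 s² + 20` is `(s - 8)² ≥ 0`. Diagonal entries get only the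
  -- trivial bound `n`; their total `n³` is of lower order than `n³ log n`.
  have hoff : ∀ u v, D u v ^ 2 ≤ 5 / 4 * s ^ 2 + 20 + if u = v then (n : ℝ) ^ 2 else 0 := by
    intro u v
    have hDuv : D u v = ∑ w, A n ω u w * A n ω w v -
      ∑ w, P (τ n ω u) (τ n ω w) * P (τ n ω w) (τ n ω v) := by
      simp [hD, Matrix.mul_apply]
    split_ifs with huv
    · have hb : ∀ F : Fin n → ℝ, (∀ w, F w ∈ Set.Icc (0 : ℝ) 1) → ∑ w, F w ∈ Set.Icc (0 : ℝ) n :=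
        fun F hF => ⟨Finset.sum_nonneg fun w _ => (hF w).1,
          (Finset.sum_le_sum fun w _ => (hF w).2).trans (by simp)⟩
      have ha := hb (fun w => A n ω u w * A n ω w v) fun w => unitInterval.mul_mem (h01 _ _) (h01 _ _)
      have hp := hb (fun w => P (τ n ω u) (τ n ω w) * P (τ n ω w) (τ n ω v))
        fun w => unitInterval.mul_mem (hP _ _) (hP _ _)
      have : D u v ^ 2 ≤ (n : ℝ) ^ 2 := by
        rw [hDuv]
        apply sq_le_sq'
        · linarith [ha.1, hp.2]
        · linarith [ha.2, hp.1]
      nlinarith [sq_nonneg s]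
    · have := hn u v huv
      rw [← hDuv] at this
      have h2 : D u v ^ 2 ≤ (s + 2) ^ 2 := by
        rw [← sq_abs]; exact pow_le_pow_left₀ (abs_nonneg _) this 2
      nlinarith [sq_nonneg (s - 8)]
  calc ∑ u, ∑ v, D u v ^ 2
      ≤ ∑ u : Fin n, ∑ v : Fin n, (5 / 4 * s ^ 2 + 20 + if u = v then (n : ℝ) ^ 2 else 0) :=
        Finset.sum_le_sum fun u _ => Finset.sum_le_sum fun v _ => hoff u v
    _ = n ^ 2 * (5 / 4 * s ^ 2 + 20 + n) := by
        simp [Finset.sum_add_distrib]; ring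
    _ ≤ n ^ 2 * (3 * (n * Real.log n)) := by
        rw [hs2]
        apply mul_le_mul_of_nonneg_left _ (by positivity)
        linarith
    _ = _ := by ring

end AlmostSure

/-! ### Frobenius norm and Euclidean inequalities. -/

section Frobenius

/-- The square of the Frobenius norm. -/
def frobSq {m n : Type*} [Fintype m] [Fintype n] (B : Matrix m n ℝ) : ℝ := ∑ i, ∑ j, B i j ^ 2

variable {m n k : Type*} [Fintype m] [Fintype n] [Fintype k]

lemma dotProduct_self_eq_sum_sq (x : n → ℝ) : x ⬝ᵥ x = ∑ i, x i ^ 2 := by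
  simp [dotProduct, sq]

lemma dotProduct_self_nonneg_real (x : n → ℝ) : 0 ≤ x ⬝ᵥ x := by
  rw [dotProduct_self_eq_sum_sq]; positivity

lemma euclNorm_sq {d : ℕ} (x : Fin d → ℝ) : euclNorm x ^ 2 = x ⬝ᵥ x := by
  rw [euclNorm, EuclideanSpace.real_norm_sq_eq, dotProduct_self_eq_sum_sq]

lemma dotProduct_sq_le (x y : n → ℝ) : (x ⬝ᵥ y) ^ 2 ≤ (x ⬝ᵥ x) * (y ⬝ᵥ y) := by
  rw [dotProduct_self_eq_sum_sq, dotProduct_self_eq_sum_sq]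
  exact Finset.sum_mul_sq_le_sq_mul_sq _ _ _

lemma dotProduct_add_self_le (x y : n → ℝ) :
    (x + y) ⬝ᵥ (x + y) ≤ 2 * (x ⬝ᵥ x) + 2 * (y ⬝ᵥ y) := by
  have := dotProduct_self_nonneg_real (x - y)
  simp only [add_dotProduct, dotProduct_add, sub_dotProduct, dotProduct_sub] at this ⊢
  linarith

lemma dotProduct_sub_self_le (x y z : n → ℝ) :
    (x - z) ⬝ᵥ (x - z) ≤ 2 * ((x - y) ⬝ᵥ (x - y)) + 2 * ((y - z) ⬝ᵥ (y - z)) := by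
  simpa using dotProduct_add_self_le (x - y) (y - z)

lemma dotProduct_sub_self_comm (x y : n → ℝ) : (x - y) ⬝ᵥ (x - y) = (y - x) ⬝ᵥ (y - x) := by
  rw [← neg_sub x y, neg_dotProduct_neg]

lemma frobSq_nonneg (B : Matrix m n ℝ) : 0 ≤ frobSq B := by unfold frobSq; positivity

lemma frobSq_eq_sum_rows (B : Matrix m n ℝ) : frobSq B = ∑ i, B i ⬝ᵥ B i := by
  simp [frobSq, dotProduct_self_eq_sum_sq]

lemma frobSq_transpose (B : Matrix m n ℝ) : frobSq Bᵀ = frobSq B := Finset.sum_comm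

lemma frobSq_eq_sum_cols (B : Matrix m n ℝ) : frobSq B = ∑ j, Bᵀ j ⬝ᵥ Bᵀ j := by
  rw [← frobSq_transpose, frobSq_eq_sum_rows]

lemma frobSq_eq_trace (B : Matrix m n ℝ) : frobSq B = (Bᵀ * B).trace := by
  rw [frobSq_eq_sum_cols]; rfl

lemma frobSq_eq_trace' (B : Matrix m n ℝ) : frobSq B = (B * Bᵀ).trace := by
  rw [frobSq_eq_trace, Matrix.trace_mul_comm]

lemma mulVec_dotProduct_self_le (B : Matrix m n ℝ) (x : n → ℝ) :
    (B *ᵥ x) ⬝ᵥ (B *ᵥ x) ≤ frobSq B * (x ⬝ᵥ x) := by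
  rw [dotProduct_self_eq_sum_sq, frobSq_eq_sum_rows, Finset.sum_mul]
  exact Finset.sum_le_sum fun i _ => dotProduct_sq_le _ _

lemma mulVec_dotProduct (B : Matrix m n ℝ) (x : n → ℝ) (y : m → ℝ) :
    (B *ᵥ x) ⬝ᵥ y = x ⬝ᵥ (Bᵀ *ᵥ y) := by
  rw [dotProduct_comm, dotProduct_mulVec, dotProduct_comm, ← mulVec_transpose]

lemma mulVec_dotProduct_mulVec (B : Matrix m n ℝ) (x y : n → ℝ) :
    (B *ᵥ x) ⬝ᵥ (B *ᵥ y) = x ⬝ᵥ ((Bᵀ * B) *ᵥ y) := by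
  rw [mulVec_dotProduct, mulVec_mulVec]

lemma frobSq_mul_orthogonal [DecidableEq n] (B : Matrix m n ℝ) {U : Matrix n n ℝ}
    (hU : U * Uᵀ = 1) : frobSq (B * U) = frobSq B := by
  rw [frobSq_eq_trace', frobSq_eq_trace', transpose_mul, Matrix.mul_assoc, ← Matrix.mul_assoc U, hU,
    Matrix.one_mul]

lemma dotProduct_projection_add_dotProduct_compl [DecidableEq n] {Q : Matrix n n ℝ} (hs : Qᵀ = Q) (hi : Q * Q = Q)
    (x : n → ℝ) : (Q *ᵥ x) ⬝ᵥ (Q *ᵥ x) + ((1 - Q) *ᵥ x) ⬝ᵥ ((1 - Q) *ᵥ x) = x ⬝ᵥ x := by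
  rw [mulVec_dotProduct_mulVec, mulVec_dotProduct_mulVec, ← dotProduct_add, ← add_mulVec]
  have : Qᵀ * Q + (1 - Q)ᵀ * (1 - Q) = 1 := by
    rw [transpose_sub, hs, transpose_one, Matrix.sub_mul, Matrix.one_mul, Matrix.mul_sub, hi,
      Matrix.mul_one]
    simp
  rw [this, one_mulVec]

end Frobenius

/-! ### Eigenvalue bounds and the Courant–Fischer argument. -/

section Spectral

variable {n d : ℕ}

lemma le_mulVec_dotProduct_of_eigenvalues {m : Type*} [Fintype m] (B : Matrix m (Fin d) ℝ) {α : ℝ}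
    (h : ∀ x : ℝ, Module.End.HasEigenvalue (Matrix.toLin' (Bᵀ * B)) x → α < x) (c : Fin d → ℝ) :
    α * (c ⬝ᵥ c) ≤ (B *ᵥ c) ⬝ᵥ (B *ᵥ c) := by
  have hH : (Bᵀ * B - α • (1 : Matrix (Fin d) (Fin d) ℝ)).IsHermitian := by
    rw [IsHermitian, conjTranspose_eq_transpose_of_trivial]
    simp [transpose_mul]
  have hp : (Bᵀ * B - α • (1 : Matrix (Fin d) (Fin d) ℝ)).PosSemidef := by
    rw [hH.posSemidef_iff_eigenvalues_nonneg]
    intro i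
    have hv := hH.mulVec_eigenvectorBasis i
    have hne : (⇑(hH.eigenvectorBasis i) : Fin d → ℝ) ≠ 0 := by
      intro h0
      exact hH.eigenvectorBasis.orthonormal.ne_zero i (by ext j; exact congrFun h0 j)
    have : Module.End.HasEigenvalue (Matrix.toLin' (Bᵀ * B)) (hH.eigenvalues i + α) := by
      refine Module.End.hasEigenvalue_of_hasEigenvector
        (x := (⇑(hH.eigenvectorBasis i) : Fin d → ℝ)) ⟨?_, hne⟩
      rw [Module.End.mem_eigenspace_iff, toLin'_apply, add_smul, ← hv, sub_mulVec, smul_mulVec,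
        one_mulVec]
      simp
    have := h _ this
    simp only [Pi.zero_apply]
    linarith
  have := hp.dotProduct_mulVec_nonneg c
  rw [sub_mulVec, smul_mulVec, one_mulVec, dotProduct_sub, dotProduct_smul] at this
  rw [mulVec_dotProduct_mulVec]
  simp at this
  exact this

/-- Each row of `B` is repeated at least `γ n` times. -/
lemma le_submatrix_mulVec_dotProduct {K : ℕ} {B : Matrix (Fin K) (Fin d) ℝ} {α γ : ℝ}
    (hB : ∀ c, α * (c ⬝ᵥ c) ≤ (B *ᵥ c) ⬝ᵥ (B *ᵥ c)) (hγ : 0 ≤ γ) {t : Fin n → Fin K}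
    (ht : ∀ i, γ * n ≤ ((Finset.univ.filter fun u => t u = i).card : ℝ)) (c : Fin d → ℝ) :
    α * γ * n * (c ⬝ᵥ c) ≤ (B.submatrix t id *ᵥ c) ⬝ᵥ (B.submatrix t id *ᵥ c) := by
  have h1 : (B.submatrix t id *ᵥ c) ⬝ᵥ (B.submatrix t id *ᵥ c) =
      ∑ i, ((Finset.univ.filter fun u => t u = i).card : ℝ) * (B *ᵥ c) i ^ 2 := by
    rw [dotProduct_self_eq_sum_sq, ← Finset.sum_fiberwise (s := Finset.univ) (g := t)]
    refine Finset.sum_congr rfl fun i _ => ?_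
    rw [← nsmul_eq_mul]
    refine Finset.sum_eq_card_nsmul fun u hu => ?_
    rw [← (Finset.mem_filter.1 hu).2]
    rfl
  calc α * γ * n * (c ⬝ᵥ c) = γ * n * (α * (c ⬝ᵥ c)) := by ring
    _ ≤ γ * n * ((B *ᵥ c) ⬝ᵥ (B *ᵥ c)) := mul_le_mul_of_nonneg_left (hB c) (by positivity)
    _ ≤ _ := by
        rw [h1, dotProduct_self_eq_sum_sq, Finset.mul_sum]
        exact Finset.sum_le_sum fun i _ => mul_le_mul_of_nonneg_right (ht i) (sq_nonneg _)

/-- The orthogonal projection onto the column space of a matrix with independent columns. -/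
lemma exists_projection {X : Matrix (Fin n) (Fin d) ℝ} {κ : ℝ} (hκ : 0 < κ)
    (hX : ∀ c, κ * (c ⬝ᵥ c) ≤ (X *ᵥ c) ⬝ᵥ (X *ᵥ c)) :
    ∃ G : Matrix (Fin d) (Fin n) ℝ, (X * G)ᵀ = X * G ∧ X * G * (X * G) = X * G ∧
      X * G * X = X ∧ (X * G).trace = d := by
  have hdet : (Xᵀ * X).det ≠ 0 := by
    intro h0
    obtain ⟨c, hc, h⟩ := exists_mulVec_eq_zero_iff.2 h0
    have := hX c
    rw [mulVec_dotProduct_mulVec, h, dotProduct_zero] at this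
    have h2 := dotProduct_self_nonneg_real c
    exact hc (dotProduct_self_eq_zero.1 (by nlinarith))
  have hu : IsUnit (Xᵀ * X).det := isUnit_iff_ne_zero.2 hdet
  have h1 : (Xᵀ * X)⁻¹ * Xᵀ * X = 1 := by rw [Matrix.mul_assoc, nonsing_inv_mul _ hu]
  refine ⟨(Xᵀ * X)⁻¹ * Xᵀ, ?_, ?_, ?_, ?_⟩
  · rw [transpose_mul, transpose_mul, transpose_transpose, transpose_nonsing_inv, transpose_mul,
      transpose_transpose, Matrix.mul_assoc]
  · rw [Matrix.mul_assoc X, ← Matrix.mul_assoc _ X, h1, Matrix.one_mul]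
  · rw [Matrix.mul_assoc X, h1, Matrix.mul_one]
  · rw [trace_mul_comm, h1, trace_one, Fintype.card_fin]

/-- By symmetry `A * A = A * Aᵀ`, so `V` cancels and left singular vectors become eigenvectors,
whatever the signs of the eigenvalues of `A`. -/
lemma sq_eq_of_svd {A U V : Matrix (Fin n) (Fin n) ℝ} {σ : Fin n → ℝ} (hA : A.IsSymm)
    (hV : Vᵀ * V = 1) (h : A = U * diagonal σ * Vᵀ) :
    A * A = U * diagonal (fun i => σ i ^ 2) * Uᵀ := by
  have h' : A * A = A * Aᵀ := by rw [hA.eq]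
  rw [h', h, transpose_mul, transpose_mul, transpose_transpose, diagonal_transpose,
    Matrix.mul_assoc (U * diagonal σ), ← Matrix.mul_assoc Vᵀ, hV, Matrix.one_mul,
    Matrix.mul_assoc U, ← Matrix.mul_assoc (diagonal σ), diagonal_mul_diagonal, Matrix.mul_assoc]
  simp [sq]

lemma mulVec_col_of_diagonalization {B U : Matrix (Fin n) (Fin n) ℝ} {s : Fin n → ℝ}
    (hU : Uᵀ * U = 1) (h : B = U * diagonal s * Uᵀ) (j : Fin n) : B *ᵥ Uᵀ j = s j • Uᵀ j := by
  have : B * U = U * diagonal s := by rw [h, Matrix.mul_assoc, hU, Matrix.mul_one]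
  ext i
  have := congrFun (congrFun this i) j
  rw [mul_diagonal] at this
  simpa [mulVec, dotProduct, Matrix.mul_apply, mul_comm] using this

lemma dotProduct_mulVec_of_diagonalization {B U : Matrix (Fin n) (Fin n) ℝ} {s : Fin n → ℝ}
    (h : B = U * diagonal s * Uᵀ) (x : Fin n → ℝ) :
    x ⬝ᵥ (B *ᵥ x) = ∑ i, s i * (Uᵀ i ⬝ᵥ x) ^ 2 := by
  rw [h, ← mulVec_mulVec, ← mulVec_mulVec, dotProduct_mulVec, ← mulVec_transpose]
  simp only [dotProduct, mulVec_diagonal]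
  refine Finset.sum_congr rfl fun i _ => ?_
  change (Uᵀ i ⬝ᵥ x) * (s i * (Uᵀ i ⬝ᵥ x)) = s i * (Uᵀ i ⬝ᵥ x) ^ 2
  ring

/-- The Courant-Fischer lower bound for an eigenvalue. -/
lemma le_of_forall_le_dotProduct_mulVec {B U : Matrix (Fin n) (Fin n) ℝ} {s : Fin n → ℝ}
    (hUU : U * Uᵀ = 1) (hs : Antitone s) (h : B = U * diagonal s * Uᵀ)
    {X : Matrix (Fin n) (Fin d) ℝ} {κ η : ℝ} (hκ : 0 < κ)
    (hX : ∀ c, κ * (c ⬝ᵥ c) ≤ (X *ᵥ c) ⬝ᵥ (X *ᵥ c))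
    (hB : ∀ c, η * ((X *ᵥ c) ⬝ᵥ (X *ᵥ c)) ≤ (X *ᵥ c) ⬝ᵥ (B *ᵥ (X *ᵥ c)))
    (j : Fin n) (hj : j.val < d) : η ≤ s j := by
  -- `L c` lists the coordinates of `X *ᵥ c` along the first `j` eigenvectors. Since `j < d`, some
  -- nonzero `c` kills them all, and the Rayleigh quotient at `X *ᵥ c` is then at most `s j`.
  let L : (Fin d → ℝ) →ₗ[ℝ] (Fin j.val → ℝ) :=
    Matrix.toLin' (Matrix.of fun (i : Fin j.val) => (Uᵀ * X) (Fin.castLE j.2.le i))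
  obtain ⟨c, hc, hc0⟩ := (Submodule.ne_bot_iff _).1
    (L.ker_ne_bot_of_finrank_lt (by simpa using hj))
  have hcpos : 0 < c ⬝ᵥ c := lt_of_le_of_ne (dotProduct_self_nonneg_real c)
    fun h0 => hc0 (dotProduct_self_eq_zero.1 h0.symm)
  set x := X *ᵥ c with hx
  have hxpos : 0 < x ⬝ᵥ x := (mul_pos hκ hcpos).trans_le (hX c)
  have horth : ∀ i : Fin n, i < j → Uᵀ i ⬝ᵥ x = 0 := by
    intro i hi
    have := congrFun (LinearMap.mem_ker.1 hc) ⟨i.1, hi⟩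
    simp only [L, toLin'_apply, Pi.zero_apply] at this
    rw [← this, hx]
    change (Uᵀ *ᵥ (X *ᵥ c)) i = ((Uᵀ * X) *ᵥ c) i
    rw [mulVec_mulVec]
  have hpars : ∑ i, (Uᵀ i ⬝ᵥ x) ^ 2 = x ⬝ᵥ x := by
    have := dotProduct_mulVec_of_diagonalization (B := 1) (U := U) (s := fun _ => 1)
      (by simp [hUU]) x
    simpa using this.symm
  have h1 := hB c
  rw [← hx, dotProduct_mulVec_of_diagonalization h] at h1
  have h2 : ∑ i, s i * (Uᵀ i ⬝ᵥ x) ^ 2 ≤ ∑ i, s j * (Uᵀ i ⬝ᵥ x) ^ 2 := by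
    refine Finset.sum_le_sum fun i _ => ?_
    rcases lt_or_ge i j with hi | hi
    · simp [horth i hi]
    · exact mul_le_mul_of_nonneg_right (hs hi) (sq_nonneg _)
  rw [← Finset.mul_sum, hpars] at h2
  exact le_of_mul_le_mul_right (h1.trans h2) hxpos

/-- With `x = X *ᵥ c` and `g = Xᵀ *ᵥ x`, Cauchy–Schwarz gives `|x|⁴ = (c ⬝ᵥ g)² ≤ |c|² |g|²`, and
`|c|² ≤ |x|² / κ`. -/
lemma mul_le_mulVec_transpose_of_le {X : Matrix (Fin n) (Fin d) ℝ} {κ : ℝ} (hκ : 0 < κ)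
    (hX : ∀ c, κ * (c ⬝ᵥ c) ≤ (X *ᵥ c) ⬝ᵥ (X *ᵥ c)) (c : Fin d → ℝ) :
    κ * ((X *ᵥ c) ⬝ᵥ (X *ᵥ c)) ≤ (Xᵀ *ᵥ (X *ᵥ c)) ⬝ᵥ (Xᵀ *ᵥ (X *ᵥ c)) := by
  set g := Xᵀ *ᵥ (X *ᵥ c)
  have h1 : (X *ᵥ c) ⬝ᵥ (X *ᵥ c) = c ⬝ᵥ g := mulVec_dotProduct _ _ _
  have h2 := dotProduct_sq_le c g
  have h3 := hX c
  rw [h1] at h3 ⊢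
  have hc := dotProduct_self_nonneg_real c
  have hg := dotProduct_self_nonneg_real g
  have hcg : 0 ≤ c ⬝ᵥ g := by rw [← h1]; exact dotProduct_self_nonneg_real _
  rcases hcg.eq_or_lt with h0 | hpos
  · rw [← h0]; simpa using hg
  · have : (c ⬝ᵥ g) * (κ * (c ⬝ᵥ g)) ≤ (c ⬝ᵥ g) * (g ⬝ᵥ g) := by nlinarith
    exact le_of_mul_le_mul_left this hpos

end Spectral

/-! ### Perturbation of the leading eigenspace. -/

section Subspace

variable {n d : ℕ}

/-- A Davis-Kahan bound: if `Q` projects onto a subspace containing the range of `B`, then leading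
eigenvectors of a perturbation `C` of `B` lie almost in that subspace. -/
lemma frobSq_one_sub_projection_mul_le {B C U Q : Matrix (Fin n) (Fin n) ℝ} {s : Fin n → ℝ}
    (hUU : U * Uᵀ = 1) (hC : ∀ j, C *ᵥ Uᵀ j = s j • Uᵀ j)
    (hQs : Qᵀ = Q) (hQi : Q * Q = Q) (hQB : Q * B = B) (hd : d ≤ n) {η : ℝ} (hη : 0 ≤ η)
    (hs : ∀ j : Fin n, j.val < d → η ≤ s j) :
    η ^ 2 * frobSq ((1 - Q) * U.submatrix id (Fin.castLE hd)) ≤ frobSq (C - B) := by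
  have hcol : ∀ j : Fin n, j.val < d → η ^ 2 * (((1 - Q) *ᵥ Uᵀ j) ⬝ᵥ ((1 - Q) *ᵥ Uᵀ j)) ≤
      ((C - B) *ᵥ Uᵀ j) ⬝ᵥ ((C - B) *ᵥ Uᵀ j) := by
    intro j hj
    -- `1 - Q` annihilates `B`, leaving only the eigenvalue relation for `C`.
    have h1 : (1 - Q) *ᵥ ((C - B) *ᵥ Uᵀ j) = s j • ((1 - Q) *ᵥ Uᵀ j) := by
      rw [sub_mulVec C B, hC, mulVec_sub, mulVec_smul, mulVec_mulVec, Matrix.sub_mul, hQB,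
        Matrix.one_mul, sub_self, zero_mulVec, sub_zero]
    have h2 := dotProduct_projection_add_dotProduct_compl hQs hQi ((C - B) *ᵥ Uᵀ j)
    rw [h1, smul_dotProduct, dotProduct_smul, smul_eq_mul, smul_eq_mul] at h2
    have h3 := dotProduct_self_nonneg_real (Q *ᵥ ((C - B) *ᵥ Uᵀ j))
    have h4 := dotProduct_self_nonneg_real ((1 - Q) *ᵥ Uᵀ j)
    have h5 : η ^ 2 ≤ s j ^ 2 := pow_le_pow_left₀ hη (hs j hj) 2
    nlinarith
  rw [← frobSq_mul_orthogonal (C - B) hUU, frobSq_eq_sum_cols, frobSq_eq_sum_cols, Finset.mul_sum]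
  calc _ ≤ ∑ j : Fin d, ((C - B) *ᵥ Uᵀ (Fin.castLE hd j)) ⬝ᵥ ((C - B) *ᵥ Uᵀ (Fin.castLE hd j)) :=
        Finset.sum_le_sum fun j _ => hcol _ j.2
    _ = ∑ j ∈ Finset.univ.map (Fin.castLEEmb hd), ((C - B) *ᵥ Uᵀ j) ⬝ᵥ ((C - B) *ᵥ Uᵀ j) := by
        rw [Finset.sum_map]; rfl
    _ ≤ _ := Finset.sum_le_sum_of_subset_of_nonneg (Finset.subset_univ _)
        fun j _ _ => dotProduct_self_nonneg_real _

/-- Two subspaces of the same dimension are equally far from each other. -/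
lemma frobSq_one_sub_mul_projection {U : Matrix (Fin n) (Fin d) ℝ} (hU : Uᵀ * U = 1)
    {Q : Matrix (Fin n) (Fin n) ℝ} (hQs : Qᵀ = Q) (hQi : Q * Q = Q) (hQt : Q.trace = d) :
    frobSq ((1 - U * Uᵀ) * Q) = frobSq ((1 - Q) * U) := by
  have h1 : (1 - U * Uᵀ)ᵀ * (1 - U * Uᵀ) = 1 - U * Uᵀ := by
    have : U * Uᵀ * (U * Uᵀ) = U * Uᵀ := by
      rw [Matrix.mul_assoc, ← Matrix.mul_assoc Uᵀ, hU, Matrix.one_mul]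
    simp [Matrix.sub_mul, Matrix.mul_sub, transpose_sub, this]
  have h2 : (1 - Q)ᵀ * (1 - Q) = 1 - Q := by
    simp [Matrix.sub_mul, Matrix.mul_sub, transpose_sub, hQs, hQi]
  -- Both sides equal `d - tr(Q U Uᵀ)`.
  rw [frobSq_eq_trace, frobSq_eq_trace, transpose_mul, transpose_mul, Matrix.mul_assoc,
    ← Matrix.mul_assoc _ _ Q, h1, Matrix.mul_assoc, ← Matrix.mul_assoc _ _ U, h2, hQs,
    Matrix.sub_mul, Matrix.mul_sub, Matrix.sub_mul, Matrix.mul_sub, Matrix.one_mul, Matrix.one_mul,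
    hQi, hU, trace_sub, trace_sub, hQt, trace_one, Fintype.card_fin, trace_mul_comm Q,
    Matrix.mul_assoc (U * Uᵀ), hQi, Matrix.mul_assoc U, trace_mul_comm U, Matrix.mul_assoc]

/-- `Uᵀ` is almost isometric on the range of `Q`: by Pythagoras the loss at `z` is `|(1 - U Uᵀ)
z|²`, controlled by the symmetry of the subspace distance. -/
lemma le_transpose_mulVec_of_projection {U : Matrix (Fin n) (Fin d) ℝ} (hU : Uᵀ * U = 1)
    {Q : Matrix (Fin n) (Fin n) ℝ} (hQs : Qᵀ = Q) (hQi : Q * Q = Q) (hQt : Q.trace = d)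
    (e : Fin n → ℝ) :
    (1 - frobSq ((1 - Q) * U)) * ((Q *ᵥ e) ⬝ᵥ (Q *ᵥ e)) ≤
      (Uᵀ *ᵥ (Q *ᵥ e)) ⬝ᵥ (Uᵀ *ᵥ (Q *ᵥ e)) := by
  set z := Q *ᵥ e with hz
  have hQz : Q *ᵥ z = z := by rw [hz, mulVec_mulVec, hQi]
  have h1 := dotProduct_projection_add_dotProduct_compl (Q := U * Uᵀ) (by simp)
    (by rw [Matrix.mul_assoc, ← Matrix.mul_assoc Uᵀ, hU, Matrix.one_mul]) z
  have h2 := mulVec_dotProduct_self_le ((1 - U * Uᵀ) * Q) z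
  rw [frobSq_one_sub_mul_projection hU hQs hQi hQt, ← mulVec_mulVec, hQz] at h2
  have h3 : ((U * Uᵀ) *ᵥ z) ⬝ᵥ ((U * Uᵀ) *ᵥ z) = (Uᵀ *ᵥ z) ⬝ᵥ (Uᵀ *ᵥ z) := by
    rw [← mulVec_mulVec, mulVec_dotProduct_mulVec, hU, one_mulVec]
  linarith

end Subspace

/-! ### From embedding error to misassigned nodes. -/

section Clustering

variable {n d K : ℕ}

/-- One representative outside `B` per block makes `i ↦ t' (r i)` injective, hence a permutation;
its inverse relabels every node outside `B` correctly. -/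
lemma misassigned_le_card {t t' : Fin n → Fin K} {B : Finset (Fin n)}
    (hsep : ∀ u v, u ∉ B → v ∉ B → t u ≠ t v → t' u ≠ t' v) (hrep : ∀ i, ∃ u, u ∉ B ∧ t u = i) :
    misassigned t t' ≤ B.card := by
  choose r hrB hr using hrep
  have hinj : Function.Injective fun i => t' (r i) := by
    intro i j hij
    by_contra hne
    exact hsep (r i) (r j) (hrB i) (hrB j) (by rwa [hr, hr]) hij
  let π : Equiv.Perm (Fin K) := Equiv.ofBijective _ (Finite.injective_iff_bijective.1 hinj)
  refine (ciInf_le (OrderBot.bddBelow _) π.symm).trans (Finset.card_le_card fun u hu => ?_)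
  by_contra huB
  refine (Finset.mem_filter.1 hu).2 ?_
  obtain ⟨i, hi⟩ := π.surjective (t' u)
  rw [← hi, Equiv.symm_apply_apply]
  by_contra hne
  exact hsep u (r i) huB (hrB i) (by rwa [hr]) hi.symm

/-- The true blocks with centroids `φ` are a competitor, so the fitted centroids `C` are close to
`N` on average. Two nodes within squared distance `g / 4` of their rows of `N` cannot share a
cluster across blocks, and `hblock` leaves such a node in every block. -/
lemma misassigned_le_of_isSquareErrorClustering {Z N : Matrix (Fin n) (Fin d) ℝ}
    {φ ψ : Matrix (Fin K) (Fin d) ℝ} {t t' : Fin n → Fin K} (hN : ∀ u, N u = φ (t u))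
    (h : IsSquareErrorClustering Z ψ t') {g : ℝ} (hg : 0 < g)
    (hgap : ∀ u v, t u ≠ t v → g ≤ (N u - N v) ⬝ᵥ (N u - N v))
    (hblock : ∀ i, 16 * frobSq (Z - N) / g < ((Finset.univ.filter fun u => t u = i).card : ℝ)) :
    (misassigned t t' : ℝ) ≤ 16 * frobSq (Z - N) / g := by
  classical
  set C : Matrix (Fin n) (Fin d) ℝ := Matrix.of fun u => ψ (t' u) with hC
  have hCu : ∀ u, C u = ψ (t' u) := fun u => rfl
  have hCZ : frobSq (Z - C) ≤ frobSq (Z - N) := by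
    have := h φ t
    simp only [squareError, euclNorm_sq, ← hN, ← hCu] at this
    rw [frobSq_eq_sum_rows, frobSq_eq_sum_rows]
    exact this
  have hCN : frobSq (C - N) ≤ 4 * frobSq (Z - N) := by
    have : frobSq (C - N) ≤ 2 * frobSq (Z - C) + 2 * frobSq (Z - N) := by
      simp only [frobSq_eq_sum_rows, Finset.mul_sum, ← Finset.sum_add_distrib]
      refine Finset.sum_le_sum fun u _ => ?_
      have := dotProduct_sub_self_le (C u) (Z u) (N u)
      rwa [dotProduct_sub_self_comm (C u) (Z u)] at this
    linarith
  set B : Finset (Fin n) := Finset.univ.filter fun u => g / 4 ≤ (C u - N u) ⬝ᵥ (C u - N u) with hB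
  have hBcard : (B.card : ℝ) ≤ 16 * frobSq (Z - N) / g := by
    rw [le_div_iff₀ hg]
    have : B.card * (g / 4) ≤ frobSq (C - N) := by
      rw [frobSq_eq_sum_rows, ← nsmul_eq_mul]
      exact (Finset.card_nsmul_le_sum B (fun u => (C u - N u) ⬝ᵥ (C u - N u)) _
        fun u hu => (Finset.mem_filter.1 hu).2).trans
        (Finset.sum_le_sum_of_subset_of_nonneg (Finset.subset_univ _)
          fun _ _ _ => dotProduct_self_nonneg_real _)
    linarith
  refine le_trans (Nat.cast_le.2 (misassigned_le_card (B := B) ?_ ?_)) hBcard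
  · intro u v hu hv huv he
    simp only [hB, Finset.mem_filter, Finset.mem_univ, true_and, not_le] at hu hv
    have h1 := dotProduct_sub_self_le (N u) (C u) (N v)
    rw [dotProduct_sub_self_comm (N u) (C u)] at h1
    have h2 : C u = C v := by rw [hCu, hCu, he]
    rw [← h2] at hv
    have h3 := hgap u v huv
    linarith
  · intro i
    by_contra! hc
    have : (Finset.univ.filter fun u => t u = i).card ≤ B.card :=
      Finset.card_le_card fun u hu => by
        by_contra hB
        exact hc u hB (Finset.mem_filter.1 hu).2
    have : ((Finset.univ.filter fun u => t u = i).card : ℝ) ≤ B.card := by exact_mod_cast this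
    linarith [hblock i]

end Clustering

/-! ### The deterministic misassignment bound. -/

section Embedding

variable {n d K : ℕ}

lemma frobSq_le_of_mem_Icc {B : Matrix (Fin n) (Fin n) ℝ} (h : ∀ i j, B i j ∈ Set.Icc (0 : ℝ) 1) :
    frobSq B ≤ (n : ℝ) ^ 2 := by
  calc frobSq B ≤ ∑ _i : Fin n, ∑ _j : Fin n, (1 : ℝ) :=
        Finset.sum_le_sum fun i _ => Finset.sum_le_sum fun j _ =>
          pow_le_one₀ (h i j).1 (h i j).2
    _ = _ := by simp [sq]

lemma dotProduct_mulVec_le_sqrt_frobSq (B : Matrix (Fin n) (Fin n) ℝ) (x : Fin n → ℝ) :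
    x ⬝ᵥ (B *ᵥ x) ≤ √(frobSq B) * (x ⬝ᵥ x) := by
  refine le_of_sq_le_sq ?_ (mul_nonneg (Real.sqrt_nonneg _) (dotProduct_self_nonneg_real x))
  rw [mul_pow, Real.sq_sqrt (frobSq_nonneg B)]
  nlinarith [dotProduct_sq_le x (B *ᵥ x), mulVec_dotProduct_self_le B x,
    dotProduct_self_nonneg_real x]

lemma transpose_mulVec_single_sub_single (B : Matrix (Fin n) (Fin d) ℝ) (u v : Fin n) :
    Bᵀ *ᵥ (Pi.single u 1 - Pi.single v 1) = B u - B v := by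
  rw [mulVec_sub, mulVec_single_one, mulVec_single_one]; rfl

/-- Since `M = M * Q` and `‖M‖_F ≤ n`, separation of columns of `M` passes to columns of `Q`; `Uᵀ`
then nearly preserves it. -/
lemma le_dotProduct_row_sub_row_mul {M : Matrix (Fin n) (Fin n) ℝ} (hM : M.IsSymm)
    (hM01 : ∀ i j, M i j ∈ Set.Icc (0 : ℝ) 1) {U : Matrix (Fin n) (Fin d) ℝ} (hU : Uᵀ * U = 1)
    {Q : Matrix (Fin n) (Fin n) ℝ} (hQs : Qᵀ = Q) (hQi : Q * Q = Q) (hQt : Q.trace = d)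
    (hQM : Q * M = M) (hε : frobSq ((1 - Q) * U) ≤ 1) (u v : Fin n) :
    (1 - frobSq ((1 - Q) * U)) * ((M *ᵥ (Pi.single u 1 - Pi.single v 1)) ⬝ᵥ
      (M *ᵥ (Pi.single u 1 - Pi.single v 1))) ≤
      (n : ℝ) ^ 2 * (((Q * U) u - (Q * U) v) ⬝ᵥ ((Q * U) u - (Q * U) v)) := by
  set e : Fin n → ℝ := Pi.single u 1 - Pi.single v 1 with he
  have hMQ : M * Q = M := by
    rw [← transpose_inj, transpose_mul, hQs, hM.eq, hQM]
  have h1 : (Q * U) u - (Q * U) v = Uᵀ *ᵥ (Q *ᵥ e) := by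
    rw [← transpose_mulVec_single_sub_single, transpose_mul, hQs, mulVec_mulVec]
  have h2 : (M *ᵥ e) ⬝ᵥ (M *ᵥ e) ≤ (n : ℝ) ^ 2 * ((Q *ᵥ e) ⬝ᵥ (Q *ᵥ e)) := by
    have : M *ᵥ e = M *ᵥ (Q *ᵥ e) := by rw [mulVec_mulVec, hMQ]
    rw [this]
    exact (mulVec_dotProduct_self_le M _).trans (mul_le_mul_of_nonneg_right
      (frobSq_le_of_mem_Icc hM01) (dotProduct_self_nonneg_real _))
  have h3 := le_transpose_mulVec_of_projection hU hQs hQi hQt e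
  rw [h1]
  calc _ ≤ (1 - frobSq ((1 - Q) * U)) * ((n : ℝ) ^ 2 * ((Q *ᵥ e) ⬝ᵥ (Q *ᵥ e))) :=
        mul_le_mul_of_nonneg_left h2 (by linarith)
    _ = (n : ℝ) ^ 2 * ((1 - frobSq ((1 - Q) * U)) * ((Q *ᵥ e) ⬝ᵥ (Q *ᵥ e))) := by ring
    _ ≤ _ := mul_le_mul_of_nonneg_left h3 (by positivity)

/-- The leading eigenvalues of `A ^ 2` are bounded below by those of `M ^ 2`. -/
lemma sub_sqrt_frobSq_le_dotProduct_mulVec {A M : Matrix (Fin n) (Fin n) ℝ}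
    {X Y : Matrix (Fin n) (Fin d) ℝ} {κ : ℝ} (hκ : 0 < κ)
    (hX : ∀ c, κ * (c ⬝ᵥ c) ≤ (X *ᵥ c) ⬝ᵥ (X *ᵥ c))
    (hY : ∀ c, κ * (c ⬝ᵥ c) ≤ (Y *ᵥ c) ⬝ᵥ (Y *ᵥ c)) (hM : M.IsSymm) (hMYX : M = Y * Xᵀ)
    (c : Fin d → ℝ) :
    (κ ^ 2 - √(frobSq (A * A - M * M))) * ((X *ᵥ c) ⬝ᵥ (X *ᵥ c)) ≤
      (X *ᵥ c) ⬝ᵥ ((A * A) *ᵥ (X *ᵥ c)) := by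
  set x := X *ᵥ c with hx
  -- One factor `κ` comes from `Y`, the other from `Xᵀ` on the range of `X`.
  have h1 : κ ^ 2 * (x ⬝ᵥ x) ≤ x ⬝ᵥ ((M * M) *ᵥ x) := by
    have h2 : x ⬝ᵥ ((M * M) *ᵥ x) = (M *ᵥ x) ⬝ᵥ (M *ᵥ x) := by
      rw [mulVec_dotProduct_mulVec, hM.eq]
    have h3 := hY (Xᵀ *ᵥ x)
    rw [mulVec_mulVec x Y Xᵀ, ← hMYX] at h3
    have h4 := mul_le_mul_of_nonneg_left (mul_le_mulVec_transpose_of_le hκ hX c) hκ.le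
    rw [← hx] at h4
    rw [h2]
    linarith
  have h5 := dotProduct_mulVec_le_sqrt_frobSq (M * M - A * A) x
  have h6 : frobSq (M * M - A * A) = frobSq (A * A - M * M) := by
    simp only [frobSq, Matrix.sub_apply]
    exact Finset.sum_congr rfl fun i _ => Finset.sum_congr rfl fun j _ => by ring
  rw [h6, sub_mulVec, dotProduct_sub] at h5
  linarith

theorem misassigned_le_of_frobSq_le {P : Matrix (Fin K) (Fin K) ℝ}
    (hP : ∀ i j, P i j ∈ Set.Icc (0 : ℝ) 1) (hPsymm : P.IsSymm)
    {ν μ : Matrix (Fin K) (Fin d) ℝ} (hfac : ν * μᵀ = P)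
    {α β γ : ℝ} (hα : 0 < α) (hβ : 0 < β) (hγ : 0 < γ)
    (hν : ∀ c, α * (c ⬝ᵥ c) ≤ (ν *ᵥ c) ⬝ᵥ (ν *ᵥ c))
    (hμ : ∀ c, α * (c ⬝ᵥ c) ≤ (μ *ᵥ c) ⬝ᵥ (μ *ᵥ c))
    (hβνμ : ∀ i j, i ≠ j → β < euclNorm (ν i - ν j) ∨ β < euclNorm (μ i - μ j))
    {t : Fin n → Fin K} {A : Matrix (Fin n) (Fin n) ℝ} (hA : A.IsSymm) (hn : 1 ≤ n)
    (ht : ∀ i, γ * n ≤ ((Finset.univ.filter fun u => t u = i).card : ℝ))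
    (hF : frobSq (A * A - P.submatrix t t * P.submatrix t t) ≤ 3 * n ^ 3 * Real.log n)
    (hn1 : 48 * Real.log n ≤ α ^ 4 * γ ^ 4 * n)
    (hn2 : 96 / (α ^ 5 * β ^ 2 * γ ^ 5) * Real.log n < γ * n)
    {U V : Matrix (Fin n) (Fin d) ℝ} {ψ : Matrix (Fin K) (Fin d) ℝ} {t' : Fin n → Fin K}
    (hUV : IsUnscaledEmbedding d A U V) (hcl : IsSquareErrorClustering U ψ t') :
    (misassigned t t' : ℝ) ≤ 96 / (α ^ 5 * β ^ 2 * γ ^ 5) * Real.log n := by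
  obtain ⟨hd, U', V', σ, hU', hV', hσ, hσ0, hsvd, hUU', -⟩ := hUV
  obtain rfl : U = U'.submatrix id (Fin.castLE hd) := by ext u j; exact hUU' u j
  have hU1 : U' * U'ᵀ = 1 := (mem_orthogonalGroup_iff (Fin n) ℝ).1 hU'
  have hU2 : U'ᵀ * U' = 1 := (mem_orthogonalGroup_iff' (Fin n) ℝ).1 hU'
  have hV2 : V'ᵀ * V' = 1 := (mem_orthogonalGroup_iff' (Fin n) ℝ).1 hV'
  have hn0 : (0 : ℝ) < n := by exact_mod_cast hn
  set M := P.submatrix t t with hMdef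
  have hM : M.IsSymm := hPsymm.submatrix t
  set X := ν.submatrix t id with hXdef
  set Y := μ.submatrix t id with hYdef
  have hMXY : M = X * Yᵀ := by rw [hMdef, ← hfac]; rfl
  have hMYX : M = Y * Xᵀ := by rw [← hM.eq, hMXY, transpose_mul, transpose_transpose]
  set κ := α * γ * n with hκdef
  have hκ : 0 < κ := by positivity
  have hX : ∀ c, κ * (c ⬝ᵥ c) ≤ (X *ᵥ c) ⬝ᵥ (X *ᵥ c) :=
    le_submatrix_mulVec_dotProduct hν hγ.le ht
  have hY : ∀ c, κ * (c ⬝ᵥ c) ≤ (Y *ᵥ c) ⬝ᵥ (Y *ᵥ c) :=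
    le_submatrix_mulVec_dotProduct hμ hγ.le ht
  obtain ⟨G, hQs, hQi, hQX, hQt⟩ := exists_projection hκ hX
  set Q := X * G with hQdef
  have hQM : Q * M = M := by rw [hMXY, ← Matrix.mul_assoc, hQX]
  set F := frobSq (A * A - M * M) with hFdef
  -- This makes the perturbation at most a quarter of `κ²`, so the eigenvalues stay above `3/4 κ²`.
  have hFκ : 16 * F ≤ κ ^ 4 := by
    have : 48 * Real.log n * n ^ 3 ≤ α ^ 4 * γ ^ 4 * n * n ^ 3 :=
      mul_le_mul_of_nonneg_right hn1 (by positivity)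
    calc 16 * F ≤ 48 * Real.log n * n ^ 3 := by linarith
      _ ≤ _ := this
      _ = κ ^ 4 := by rw [hκdef]; ring
  have hE : √F ≤ κ ^ 2 / 4 := by
    apply Real.sqrt_le_iff.2
    exact ⟨by positivity, by nlinarith⟩
  have hdiag := sq_eq_of_svd hA hV2 hsvd
  have hanti : Antitone fun i => σ i ^ 2 := fun i j hij => pow_le_pow_left₀ (hσ0 j) (hσ hij) 2
  set U := U'.submatrix id (Fin.castLE hd) with hUdef
  have hUU : Uᵀ * U = 1 := by
    change (U'ᵀ * U').submatrix (Fin.castLE hd) (Fin.castLE hd) = 1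
    rw [hU2, submatrix_one _ (Fin.castLE_injective hd)]
  have hη := le_of_forall_le_dotProduct_mulVec hU1 hanti hdiag hκ hX
    (sub_sqrt_frobSq_le_dotProduct_mulVec (A := A) hκ hX hY hM hMYX)
  have hdk := frobSq_one_sub_projection_mul_le hU1 (mulVec_col_of_diagonalization hU2 hdiag)
    hQs hQi (B := M * M) (by rw [← Matrix.mul_assoc, hQM]) hd
    (η := κ ^ 2 - √F) (by nlinarith [sq_nonneg κ]) hη
  rw [← hUdef] at hdk
  set ε := frobSq ((1 - Q) * U) with hεdef
  have hε0 : 0 ≤ ε := frobSq_nonneg _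
  have hεF : 9 / 16 * κ ^ 4 * ε ≤ F := by
    have : (3 / 4 * κ ^ 2) ^ 2 ≤ (κ ^ 2 - √F) ^ 2 :=
      pow_le_pow_left₀ (by positivity) (by linarith) 2
    calc 9 / 16 * κ ^ 4 * ε = (3 / 4 * κ ^ 2) ^ 2 * ε := by ring
      _ ≤ (κ ^ 2 - √F) ^ 2 * ε := mul_le_mul_of_nonneg_right this hε0
      _ ≤ F := hdk
  have hε9 : ε ≤ 1 / 9 := by
    have hκ4 : 0 < κ ^ 4 := by positivity
    have : κ ^ 4 * ε ≤ κ ^ 4 * (1 / 9) := by linarith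
    exact le_of_mul_le_mul_left this hκ4
  -- Either factorization of `M` may be used, so separation of the rows of just one of `ν`, `μ`
  -- suffices.
  have hsep : ∀ u v, t u ≠ t v → κ * β ^ 2 ≤ (M *ᵥ (Pi.single u 1 - Pi.single v 1)) ⬝ᵥ
      (M *ᵥ (Pi.single u 1 - Pi.single v 1)) := by
    have aux : ∀ {B : Matrix (Fin n) (Fin d) ℝ} {x : Fin d → ℝ},
        (∀ c, κ * (c ⬝ᵥ c) ≤ (B *ᵥ c) ⬝ᵥ (B *ᵥ c)) → β < euclNorm x →
        κ * β ^ 2 ≤ (B *ᵥ x) ⬝ᵥ (B *ᵥ x) := fun {B x} hB hx =>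
      (mul_le_mul_of_nonneg_left (by rw [← euclNorm_sq]; exact pow_le_pow_left₀ hβ.le hx.le 2)
        hκ.le).trans (hB x)
    intro u v huv
    rcases hβνμ _ _ huv with h | h
    · rw [hMYX, ← mulVec_mulVec, transpose_mulVec_single_sub_single]
      exact aux hY h
    · rw [hMXY, ← mulVec_mulVec, transpose_mulVec_single_sub_single]
      exact aux hX h
  set g := 8 / 9 * (κ * β ^ 2) / n ^ 2 with hgdef
  have hg : 0 < g := by positivity
  have hgap : ∀ u v, t u ≠ t v →
      g ≤ ((Q * U) u - (Q * U) v) ⬝ᵥ ((Q * U) u - (Q * U) v) := by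
    intro u v huv
    rw [hgdef, div_le_iff₀' (by positivity)]
    refine le_trans ?_ (le_dotProduct_row_sub_row_mul hM (fun i j => hP _ _) hUU hQs hQi hQt hQM
      (by linarith) u v)
    exact mul_le_mul (by linarith) (hsep u v huv) (by positivity) (by linarith)
  have hZN : frobSq (U - Q * U) = ε := by rw [hεdef, Matrix.sub_mul, Matrix.one_mul]
  -- The constant is `16 · 3 · (16/9) · (9/8) = 96`.
  have hbound : 16 * ε / g ≤ 96 / (α ^ 5 * β ^ 2 * γ ^ 5) * Real.log n := by
    have h1 : 9 / 16 * κ ^ 4 * ε ≤ 3 * n ^ 3 * Real.log n := hεF.trans hF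
    rw [hgdef, div_le_iff₀ (by positivity)]
    have h2 : ε ≤ 3 * n ^ 3 * Real.log n / (9 / 16 * κ ^ 4) := by
      rw [le_div_iff₀ (by positivity)]; linarith
    refine (mul_le_mul_of_nonneg_left h2 (by norm_num)).trans_eq ?_
    rw [hκdef]
    field_simp
    ring
  rw [← hZN] at hbound
  refine (misassigned_le_of_isSquareErrorClustering (N := Q * U) (φ := ν * (G * U))
    ?_ hcl hg hgap fun i => (hbound.trans_lt hn2).trans_le (ht i)).trans hbound
  intro u
  rw [hQdef, Matrix.mul_assoc]
  rfl

end Embedding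

/-! ### Conclusion for large `n`. -/

lemma eventually_mul_log_le {c C : ℝ} (hC : 0 < C) :
    ∀ᶠ n : ℕ in atTop, c * Real.log n < C * n := by
  have h := (Real.isLittleO_log_id_atTop.comp_tendsto tendsto_natCast_atTop_atTop).bound
    (show 0 < C / (|c| + 1) by positivity)
  filter_upwards [h, eventually_ge_atTop 1] with n hn h1
  have h1' : (1 : ℝ) ≤ n := by exact_mod_cast h1
  simp only [Function.comp, id, Real.norm_eq_abs] at hn
  rw [abs_of_nonneg (Real.log_nonneg h1'), abs_of_nonneg (by linarith : (0 : ℝ) ≤ n)] at hn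
  calc c * Real.log n ≤ |c| * Real.log n :=
        mul_le_mul_of_nonneg_right (le_abs_self c) (Real.log_nonneg h1')
    _ ≤ |c| * (C / (|c| + 1) * n) := mul_le_mul_of_nonneg_left hn (abs_nonneg c)
    _ = (|c| / (|c| + 1)) * (C * n) := by ring
    _ < 1 * (C * n) := by
        apply mul_lt_mul_of_pos_right _ (by positivity)
        rw [div_lt_one (by positivity)]; linarith
    _ = C * n := one_mul _

theorem theorem2 {Ω : Type*} [MeasurableSpace Ω] (Pr : Measure Ω) [IsProbabilityMeasure Pr]
    (K d : ℕ) (P : Matrix (Fin K) (Fin K) ℝ) (ρ : Fin K → ℝ)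
    (hP : ∀ i j, P i j ∈ Set.Icc (0 : ℝ) 1) (hPsymm : P.IsSymm) (hrank : P.rank = d)
    (hρ : ∑ i, ρ i = 1)
    (ν μ : Matrix (Fin K) (Fin d) ℝ) (hfac : ν * μᵀ = P)
    (α β γ : ℝ) (hα : 0 < α) (hβ : 0 < β) (hγ : 0 < γ)
    (hαν : ∀ x : ℝ, Module.End.HasEigenvalue (Matrix.toLin' (νᵀ * ν)) x → α < x)
    (hαμ : ∀ x : ℝ, Module.End.HasEigenvalue (Matrix.toLin' (μᵀ * μ)) x → α < x)
    (hβνμ : ∀ i j, i ≠ j → β < euclNorm (ν i - ν j) ∨ β < euclNorm (μ i - μ j))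
    (hγρ : ∀ i, γ < ρ i)
    (τ : (n : ℕ) → Ω → Fin n → Fin K) (A : (n : ℕ) → Ω → Matrix (Fin n) (Fin n) ℝ)
    (hSBM : ∀ n, IsUndirectedSBM Pr P ρ (τ n) (A n)) :
    ∀ᵐ ω ∂Pr, ∀ᶠ n : ℕ in atTop,
      ∀ (U V : Matrix (Fin n) (Fin d) ℝ) (ψ : Matrix (Fin K) (Fin d) ℝ) (τhat : Fin n → Fin K),
        IsUnscaledEmbedding d (A n ω) U V → IsSquareErrorClustering U ψ τhat →
          (misassigned (τ n ω) τhat : ℝ)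
            ≤ 2 ^ 2 * 3 ^ 2 * 6 / (α ^ 5 * β ^ 2 * γ ^ 5) * Real.log n := by

  filter_upwards [ae_eventually_le_blockSize hSBM hγ hγρ, ae_eventually_sum_sq_le hSBM hP]
    with ω hω1 hω2
  filter_upwards [hω1, hω2, eventually_ge_atTop 1,
    eventually_mul_log_le (c := 48) (show 0 < α ^ 4 * γ ^ 4 by positivity),
    eventually_mul_log_le (c := 96 / (α ^ 5 * β ^ 2 * γ ^ 5)) hγ] with n h1 h2 hn h3 h4
  intro U V ψ τhat hUV hcl
  refine (misassigned_le_of_frobSq_le hP hPsymm hfac hα hβ hγ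
    (le_mulVec_dotProduct_of_eigenvalues ν hαν) (le_mulVec_dotProduct_of_eigenvalues μ hαμ) hβνμ
    ((hSBM n).isAdjMatrix ω).symm hn h1 h2 h3.le h4 hUV hcl).trans ?_
  -- The argument yields `96`, which is below `2² · 3² · 6 = 216`.
  exact mul_le_mul_of_nonneg_right (by gcongr; norm_num)
    (Real.log_nonneg (by exact_mod_cast hn))
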